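/- Let $\mathbf A$ be a finite algebra (a finite set $A$ with any family of finitary operations). A *polynomial* of arity $m$ over $\mathbf A$ is a term built from the variables $x_1,\dots,x_m$ and elements of $A$ using the operation symbols of $\mathbf A$. A *Mal'cev term* of $\mathbf A$ is a ternary term $t$ with $t(y,x,x)=t(x,x,y)=y$ for all $x,y\in A$. For congruences $\alpha_1,\dots,\alpha_k$ of $\mathbf A$ ($k\ge 1$), the commutator $[\alpha_1,\dots,\alpha_k]$ is the smallest congruence $\delta$ of $\mathbf A$ such that for every polynomial $f(\bar x_1,\dots,\bar x_k)$ in $k$ blocks of variables and all tuples $\bar a_i,\bar b_i$ with $\bar a_i\equiv_{\alpha_i}\bar b_i$ (entrywise): writing $\bar c_i^{\,0}=\bar a_i$ and $\bar c_i^{\,1}=\bar b_i$, if $$f(\bar a_1,\bar c_2^{\,s_2},\dots,\bar c_k^{\,s_k})\equiv_\delta f(\bar b_1,\bar c_2^{\,s_2},\dots,\bar c_k^{\,s_k})\quad\text{for all }(s_2,\dots,s_k)\in\{0,1\}^{k-1}\setminus\{(1,\dots,1)\},$$ then $f(\bar a_1,\bar b_2,\dots,\bar b_k)\equiv_\delta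 f(\bar b_1,\bar b_2,\dots,\bar b_k)$. The algebra $\mathbf A$ is *supernilpotent of degree $n$* if the commutator $[\mathbf 1,\dots,\mathbf 1]$ of $n+1$ copies of the total relation on $A$ is the identity relation on $A$. Suppose that $\mathbf A$ has a Mal'cev term and is supernilpotent of degree $n$. Then there exists a positive integer $d=d(\mathbf A)$ such that for every $0\in A$, every $m\ge d$, every polynomial $f$ of arity $m$ over $\mathbf A$ and every $\bar b=(b_1,\dots,b_m)\in A^m$ there exists a set $T\subseteq\{1,\dots,m\}$ with $|T|\le d$ and $f(\bar b_T)=f(\bar b)$, where $\bar b_T\in A^m$ is the tuple whose $i$-th entry is $b_i$ if $i\in T$ and $0$ otherwise. -/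

import Mathlib

namespace UnivAlg

open FirstOrder

/- An algebra on the set `A` is an `L`-structure for an algebraic first-order language `L`
(operation symbols only, of arbitrary finite arities, possibly infinitely many of them). -/

variable (L : Language) {A : Type*} [L.Structure A]

/-- A polynomial over the algebra `A` in the variables `ι`: a term built from variables and
elements of `A` (the left summand) using the operation symbols of `L`. -/
abbrev Poly (A ι : Type*) := L.Term (A ⊕ ι)

variable {L} in
/-- The value of a polynomial at the assignment `v`; elements of `A` denote themselves. -/
def Poly.eval {ι : Type*} (f : Poly L A ι) (v : ι → A) : A :=
  Language.Term.realize (Sum.elim id v) f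

variable (A) in
/-- The algebra `A` has a Mal'cev term: a ternary term `t` with `t(y,x,x) = t(x,x,y) = y`. -/
def HasMalcevTerm : Prop :=
  ∃ t : L.Term (Fin 3), ∀ x y : A,
    t.realize ![y, x, x] = y ∧ t.realize ![x, x, y] = y

/-- Congruence relations: equivalence relations compatible with all basic operations. -/
def IsCongruence (δ : Setoid A) : Prop :=
  ∀ (k : ℕ) (f : L.Functions k) (x y : Fin k → A),
    (∀ i, δ (x i) (y i)) → δ (Language.Structure.funMap f x) (Language.Structure.funMap f y)

/-- Given blocks of tuples `a i`, `b i`, the assignment that uses the tuple `b i` on the blocks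
`i` with `s i = true` and the tuple `a i` on the other blocks. -/
def mix {K : ℕ} {p : Fin K → ℕ} (a b : ∀ i, Fin (p i) → A) (s : Fin K → Bool) :
    (Σ i, Fin (p i)) → A :=
  fun x => if s x.1 then b x.1 x.2 else a x.1 x.2

/-- The (higher) term condition modulo `δ` for the relations `α 0, …, α k`. The choices of
`a i` or `b i` in the blocks `1, …, k` are indexed by `c : Fin k → Bool`; the choice that takes
`b i` in all these blocks is the one left out in the premise. -/
def TermCondition {k : ℕ} (α : Fin (k + 1) → Setoid A) (δ : Setoid A) : Prop :=
  ∀ (p : Fin (k + 1) → ℕ) (f : Poly L A (Σ i, Fin (p i))) (a b : ∀ i, Fin (p i) → A),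
    (∀ i j, α i (a i j) (b i j)) →
    (∀ c : Fin k → Bool, c ≠ (fun _ => true) →
      δ (f.eval (mix a b (Fin.cons false c))) (f.eval (mix a b (Fin.cons true c)))) →
    δ (f.eval (mix a b (Fin.cons false fun _ => true)))
      (f.eval (mix a b (Fin.cons true fun _ => true)))

/-- The higher commutator `[α 0, …, α k]`, the smallest congruence satisfying the term
condition (see `isLeast_commutator`). -/
def commutator {k : ℕ} (α : Fin (k + 1) → Setoid A) : Setoid A :=
  sInf {δ | IsCongruence L δ ∧ TermCondition L α δ}

theorem isLeast_commutator {k : ℕ} (α : Fin (k + 1) → Setoid A) :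
    IsLeast {δ : Setoid A | IsCongruence L δ ∧ TermCondition L α δ} (commutator L α) := by
  refine ⟨⟨?_, ?_⟩, fun δ h => sInf_le h⟩
  · intro n f x y h δ hδ
    exact hδ.1 n f x y fun i => h i δ hδ
  · intro p f a b hab h δ hδ
    exact hδ.2 p f a b hab fun c hc => h c hc δ hδ

variable (A) in
/-- `A` is supernilpotent of degree `n`: the commutator of `n + 1` copies of the total
relation is the identity relation. -/
def IsSupernilpotent (n : ℕ) : Prop :=
  commutator L (fun _ : Fin (n + 1) => (⊤ : Setoid A)) = ⊥

/-- The tuple `b_T`: entries indexed by `T` are kept, all others are replaced by `zero`. -/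
def keep {A : Type*} {m : ℕ} (zero : A) (b : Fin m → A) (T : Finset (Fin m)) : Fin m → A :=
  fun i => if i ∈ T then b i else zero

end UnivAlg

namespace UnivAlg

open FirstOrder

/-! Take `T` minimal with `f(b_T) = f(b)`. If `T` were large, color the subsets of `T` by the values
of `f`. Since `A` is finite, `exists_labelling` finds disjoint blocks in `T` such that zeroing block
`0` does not change the value once another block is zeroed. These equalities are the premises of the
term condition for equality, so block `0` can be zeroed alone, against minimality. -/

/-- An iterated Hales-Jewett theorem. The coordinates of a cube of large dimension can be partly
distributed into blocks `0, …, n` (unlabelled coordinates are set to `true`), where the block `0`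
is nonempty, such that the color of a word that is constant on blocks does not depend on its value
on the block `0`, provided that it is `false` on some other block. -/
theorem exists_labelling (κ : Type*) [Finite κ] (n : ℕ) :
    ∃ (ι : Type) (_ : Fintype ι), ∀ C : (ι → Bool) → κ, ∃ l : ι → Option (Fin (n + 1)),
      (∃ i, l i = some 0) ∧ ∀ s t : Fin (n + 1) → Bool, (∀ j : Fin n, s j.succ = t j.succ) →
        (∃ j : Fin n, s j.succ = false) →
        C (fun i => (l i).elim true s) = C (fun i => (l i).elim true t) := by
  induction n with
  | zero =>
    refine ⟨Unit, inferInstance, fun C => ⟨fun _ => some 0, ⟨(), rfl⟩, ?_⟩⟩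
    rintro s t - ⟨j, -⟩
    exact j.elim0
  | succ n ih =>
    obtain ⟨η, _, hη⟩ := ih
    obtain ⟨ι, hfin, hι⟩ := Combinatorics.Subspace.exists_mono_in_high_dimension Bool κ η
    refine ⟨ι, hfin, fun C => ?_⟩
    obtain ⟨S, c, hS⟩ := hι C
    -- The fixed coordinates of `S` that are `false` will form the new last block. If it is `false`,
    -- the word lies in the monochromatic `S`; if `true`, all fixed coordinates are `true` and the
    -- induction hypothesis applies to this coloring.
    obtain ⟨l, ⟨e, he⟩, hl⟩ := hη fun y => C fun i => (S.idxFun i).elim (fun _ => true) y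
    have top : ∀ s : Fin (n + 2) → Bool, s (Fin.last _) = true →
        (fun i => ((S.idxFun i).elim (fun x => if x then none else some (Fin.last _))
          fun e => (l e).map Fin.castSucc : Option (Fin (n + 2))).elim true s) =
        fun i => (S.idxFun i).elim (fun _ => true)
          fun e => (l e).elim true fun j => s j.castSucc := by
      intro s hs
      funext i
      rcases S.idxFun i with (_ | _) | e
      · simpa using hs
      · simp
      · cases h : l e <;> simp [h]
    have bot : ∀ s : Fin (n + 2) → Bool, s (Fin.last _) = false →
        (fun i => ((S.idxFun i).elim (fun x => if x then none else some (Fin.last _))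
          fun e => (l e).map Fin.castSucc : Option (Fin (n + 2))).elim true s) =
        S fun e => (l e).elim true fun j => s j.castSucc := by
      intro s hs
      funext i
      rw [Combinatorics.Subspace.apply_def]
      rcases S.idxFun i with (_ | _) | e
      · simpa using hs
      · simp
      · cases h : l e <;> simp [h]
    refine ⟨fun i => (S.idxFun i).elim (fun x => if x then none else some (Fin.last _))
      fun e => (l e).map Fin.castSucc, ?_, fun s t hst hs => ?_⟩
    · obtain ⟨i, hi⟩ := S.proper e
      exact ⟨i, by simp [hi, he]⟩
    · have hlast : s (Fin.last _) = t (Fin.last _) := hst (Fin.last n)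
      cases h : s (Fin.last _) with
      | false => rw [bot s h, bot t (hlast ▸ h), hS, hS]
      | true =>
        rw [top s h, top t (hlast ▸ h)]
        refine hl (fun j => s j.castSucc) (fun j => t j.castSucc) (fun j => hst j.castSucc) ?_
        obtain ⟨j, hj⟩ := hs
        induction j using Fin.lastCases with
        | last => simp [← Fin.succ_last, hj] at h
        | cast j => exact ⟨j, hj⟩

variable {L : Language} {A : Type*} [L.Structure A]

/-- In a supernilpotent algebra, the equality relation satisfies the term condition. -/
theorem IsSupernilpotent.termCondition {n : ℕ} (hA : IsSupernilpotent L A n) :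
    TermCondition L (fun _ : Fin (n + 1) => (⊤ : Setoid A)) ⊥ :=
  hA ▸ (isLeast_commutator L fun _ : Fin (n + 1) => (⊤ : Setoid A)).1.2

/-- The term condition for a polynomial whose variables are partly distributed into blocks, where
in each block one switches between `zero` and the entries of `v`. -/
theorem IsSupernilpotent.eval_eq_of_labelling {n m : ℕ} (hA : IsSupernilpotent L A n)
    (f : Poly L A (Fin m)) (zero : A) (v : Fin m → A) (l : Fin m → Option (Fin (n + 1)))
    (h : ∀ c : Fin n → Bool, c ≠ (fun _ => true) →
      f.eval (fun x => if (l x).elim true (Fin.cons false c) then v x else zero) =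
        f.eval (fun x => if (l x).elim true (Fin.cons true c) then v x else zero)) :
    f.eval (fun x => if l x = some 0 then zero else v x) = f.eval v := by
  -- Unlabelled variables become the constants `v x`. Each block gets `m` variables, of which only
  -- those with its label occur.
  have key : ∀ s : Fin (n + 1) → Bool,
      Poly.eval (L := L) (ι := Σ _ : Fin (n + 1), Fin m)
        (Language.Term.relabel (Sum.elim Sum.inl fun x =>
          (l x).elim (Sum.inl (v x)) fun j => Sum.inr ⟨j, x⟩) f)
        (mix (p := fun _ => m) (fun _ _ => zero) (fun _ => v) s) =
      f.eval (fun x => if (l x).elim true s then v x else zero) := by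
    intro s
    rw [Poly.eval, Poly.eval, Language.Term.realize_relabel]
    congr 1
    funext x
    rcases x with x | x
    · rfl
    · cases hx : l x <;> simp [hx, mix]
  have := hA.termCondition (fun _ => m)
    (Language.Term.relabel (Sum.elim Sum.inl fun x =>
      (l x).elim (Sum.inl (v x)) fun j => Sum.inr ⟨j, x⟩) f)
    (fun _ _ => zero) (fun _ => v) (fun _ _ => trivial) fun c hc => by
      rw [key, key]
      exact h c hc
  rw [key, key] at this
  have this : _ = _ := this
  convert! this using 2 <;> funext x
  · rcases hx : l x with _ | j
    · simp
    · refine Fin.cases ?_ (fun j => ?_) j <;> simp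
  · rcases hx : l x with _ | j
    · simp
    · refine Fin.cases ?_ (fun j => ?_) j <;> simp

/-- In a finite supernilpotent algebra, the entries of a sufficiently large set of variables can be
partly replaced by `zero` without changing the value of a polynomial. -/
theorem IsSupernilpotent.exists_ssubset_eval_keep_eq [Finite A] {n : ℕ}
    (hA : IsSupernilpotent L A n) :
    ∃ d : ℕ, ∀ (zero : A) (m : ℕ) (f : Poly L A (Fin m)) (b : Fin m → A) (T : Finset (Fin m)),
      d ≤ T.card → ∃ U ⊂ T, f.eval (keep zero b U) = f.eval (keep zero b T) := by
  classical
  obtain ⟨ι, _, hι⟩ := exists_labelling A n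
  refine ⟨Fintype.card ι, fun zero m f b T hT => ?_⟩
  obtain ⟨e⟩ : Nonempty (ι ↪ T) := Function.Embedding.nonempty_of_card_le (by simpa using hT)
  let g : ι → Fin m := fun i => e i
  have hg : g.Injective := Subtype.val_injective.comp e.injective
  -- Variables outside the range of `g` keep their entry in `b_T`.
  obtain ⟨l, ⟨i, hi⟩, hl⟩ := hι fun y => f.eval fun x =>
    if Function.extend g y (fun _ => true) x then keep zero b T x else zero
  have hext : ∀ s : Fin (n + 1) → Bool,
      Function.extend g (fun i => (l i).elim true s) (fun _ => true) =
        fun x => (Function.extend g l (fun _ => none) x).elim true s := by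
    intro s
    funext x
    by_cases hx : ∃ i, g i = x
    · obtain ⟨i, rfl⟩ := hx
      simp [hg.extend_apply]
    · simp [Function.extend_apply' _ _ _ hx]
  have := hA.eval_eq_of_labelling f zero (keep zero b T) (Function.extend g l fun _ => none) (by
    intro c hc
    obtain ⟨j, hj⟩ := Function.ne_iff.1 hc
    have := hl (Fin.cons false c) (Fin.cons true c) (fun j => rfl) ⟨j, by simpa using hj⟩
    simpa only [hext] using this)
  refine ⟨T.filter fun x => Function.extend g l (fun _ => none) x ≠ some 0, ?_, ?_⟩
  · refine Finset.filter_ssubset.2 ⟨g i, (e i).2, ?_⟩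
    simp [hg.extend_apply, hi]
  · rw [← this]
    congr 1
    funext x
    by_cases hx : Function.extend g l (fun _ => none) x = some 0 <;> simp [keep, hx]

end UnivAlg

theorem lemma2p3 {L : FirstOrder.Language} [L.IsAlgebraic] {A : Type*} [L.Structure A] [Finite A]
    (n : ℕ) (hM : UnivAlg.HasMalcevTerm L A) (hA : UnivAlg.IsSupernilpotent L A n) :
    ∃ d : ℕ, 0 < d ∧ ∀ zero : A, ∀ m : ℕ, d ≤ m →
      ∀ (f : UnivAlg.Poly L A (Fin m)) (b : Fin m → A),
        ∃ T : Finset (Fin m), T.card ≤ d ∧ f.eval (UnivAlg.keep zero b T) = f.eval b := by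
  obtain ⟨d, hd⟩ := hA.exists_ssubset_eval_keep_eq
  -- The successor only ensures positivity.
  refine ⟨d + 1, d.succ_pos, fun zero m _ f b => ?_⟩
  have hne : ∃ T : Finset (Fin m), f.eval (UnivAlg.keep zero b T) = f.eval b :=
    ⟨Finset.univ, by congr 1; funext x; simp [UnivAlg.keep]⟩
  obtain ⟨T, hT, hmin⟩ := WellFounded.has_min (wellFounded_lt (α := Finset (Fin m)))
    {T | f.eval (UnivAlg.keep zero b T) = f.eval b} hne
  refine ⟨T, ?_, hT⟩
  by_contra h
  obtain ⟨U, hU, hUT⟩ := hd zero m f b T (by omega)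
  exact hmin U (hUT.trans hT) hU
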